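/- Let $\Sigma$ be a finite alphabet with a linear order $\prec$. Extend $\prec$ to the (strict) co-lexicographic order on $\Sigma^*$: words are compared letter by letter from right to left, and a proper suffix of a word precedes that word. All automata are finite, have a unique initial state, may be incomplete, and are trim: every state is reachable from the initial state and can reach a final state. A Wheeler automaton is a nondeterministic automaton $(Q,s,\delta,F)$ together with a linear order $<$ on $Q$ such that $s$ is the minimum of $Q$ and has no incoming transitions, and such that for all $v_1\in\delta(u_1,a_1)$ and $v_2\in\delta(u_2,a_2)$: (i) if $a_1\prec a_2$ then $v_1<v_2$; (ii) if $a_1=a_2$ and $u_1<u_2$ then $v_1\le v_2$. A language is called Wheeler if it is recognized by a Wheeler automaton. **Theorem.** Let $\mathcal A$ be the minimum edge-labelled DFA recognizing a regular language $\mathcal L\subseteq\Sigma^*$, let $s$ be its initial state and $|\mathcal A|$ its number of states. Here "minimum" means having the least number of states either among all DFAs recognizing $\mathcal L$, or among all DFAs recognizing $\mathcal L$ whose initial state has no incoming transitions (in which case $\mathcal A$ is also required to have this property); the theorem holds with either convention. Then $\mathcal L$ is not Wheeler if and only if there exist strings $\mu,\nu,\gamma\in\Sigma^*$ and states $u,v$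 of $\mathcal A$ such that: 1. $\mu$ and $\nu$ label paths from $s$ to $u$ and to $v$, respectively, and $u\neq v$; 2. $\gamma$ labels a cycle from $u$ to $u$ and a cycle from $v$ to $v$; 3. either $\mu\prec\gamma$ and $\nu\prec\gamma$, or $\gamma\prec\mu$ and $\gamma\prec\nu$; 4. $|\mu|<|\gamma|$, $|\nu|<|\gamma|$, and $|\gamma|\le 2+|\mathcal A|+2|\mathcal A|^2+|\mathcal A|^3$. -/

import Mathlib

namespace WheelerLang

universe u v

/-- The strict co-lexicographic order on words: words are compared letter by letter from right
to left, and a proper suffix of a word precedes the word. -/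
def ColexLT {α : Type u} [LinearOrder α] (x y : List α) : Prop :=
  List.Lex (· < ·) x.reverse y.reverse

/-- The nondeterministic automaton `A` has the unique initial state `s`, every state is reachable
from `s`, and from every state an accepting state can be reached. -/
structure IsTrimFrom {α : Type u} {Q : Type v} (A : NFA α Q) (s : Q) : Prop where
  start_eq : A.start = {s}
  reachable : ∀ q : Q, ∃ w : List α, q ∈ A.evalFrom {s} w
  coreachable : ∀ q : Q, ∃ w : List α, ∃ f ∈ A.accept, f ∈ A.evalFrom {q} w

/-- No transition of `A` enters the state `s`. -/
def NoIncoming {α : Type u} {Q : Type v} (A : NFA α Q) (s : Q) : Prop :=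
  ∀ (q : Q) (a : α), s ∉ A.step q a

/-- `A` is a (possibly incomplete) trim deterministic automaton with initial state `s` that
recognizes `L`. -/
structure IsDFAFor {α : Type u} {Q : Type v} (A : NFA α Q) (s : Q) (L : Language α) : Prop where
  trim : IsTrimFrom A s
  deterministic : ∀ (q : Q) (a : α), (A.step q a).Subsingleton
  accepts_eq : A.accepts = L

/-- `A` has the least number of states among all finite trim deterministic automata
recognizing `L`. -/
structure IsMinimumDFA {α : Type u} {Q : Type v} (A : NFA α Q) (s : Q) (L : Language α) :
    Prop where
  isDFA : IsDFAFor A s L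
  card_le : ∀ (Q' : Type v) [Finite Q'] (B : NFA α Q') (t : Q'),
    IsDFAFor B t L → Nat.card Q ≤ Nat.card Q'

/-- The variant of `IsMinimumDFA` for the convention that the initial state of an automaton has
no incoming transitions: `A` obeys the convention, and it has the least number of states among
all finite trim deterministic automata that obey the convention and recognize `L`. -/
structure IsMinimumRootedDFA {α : Type u} {Q : Type v} (A : NFA α Q) (s : Q) (L : Language α) :
    Prop where
  isDFA : IsDFAFor A s L
  noIncoming : NoIncoming A s
  card_le : ∀ (Q' : Type v) [Finite Q'] (B : NFA α Q') (t : Q'),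
    IsDFAFor B t L → NoIncoming B t → Nat.card Q ≤ Nat.card Q'

/-- The linear order of the states makes `A` a Wheeler automaton with initial state `s`. -/
structure IsWheelerNFA {α : Type u} [LinearOrder α] {Q : Type v} [LinearOrder Q]
    (A : NFA α Q) (s : Q) : Prop where
  trim : IsTrimFrom A s
  start_le : ∀ q : Q, s ≤ q
  noIncoming : NoIncoming A s
  lt_of_label_lt : ∀ (u₁ u₂ v₁ v₂ : Q) (a₁ a₂ : α), v₁ ∈ A.step u₁ a₁ → v₂ ∈ A.step u₂ a₂ →
    a₁ < a₂ → v₁ < v₂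
  le_of_source_lt : ∀ (u₁ u₂ v₁ v₂ : Q) (a : α), v₁ ∈ A.step u₁ a → v₂ ∈ A.step u₂ a →
    u₁ < u₂ → v₁ ≤ v₂

/-- A language is Wheeler if a finite Wheeler automaton recognizes it. -/
def IsWheelerLanguage {α : Type u} [LinearOrder α] (L : Language α) : Prop :=
  ∃ (Q : Type) (_ : Finite Q) (_ : LinearOrder Q) (A : NFA α Q) (s : Q),
    IsWheelerNFA A s ∧ A.accepts = L

end WheelerLang

/-! Co-lexicographic order makes Wheeler automata behave like ordered partitions: prefixes of the
language that reach the same set of states form a convex class among all prefixes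
(`IsWheelerNFA.evalFrom_eq_of_colexLT`).

If `μ`, `ν`, `γ` are as in the theorem, the words `μγ^i` and `νγ^j` with increasing exponents
interleave. A Wheeler automaton has finitely many state sets, so two words `μγ^(2i)`, `μγ^(2j)`
reach the same one, and `νγ^(2i+1)`, lying between them, reaches it too. Hence `u` and `v` have the
same right language, contrary to minimality.

Conversely, write `N` for the number of states and colour each prefix by its state and its suffix of
length at most `N^3`. If the colours are convex, they are the states of a Wheeler automaton
(`isWheelerLanguage_of_convex`). Otherwise three words with a common suffix of length `N^3` lead to
states of which the middle one differs from the outer ones. Reading the suffix repeats a triple of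
states, which yields a common cycle. A power of the cycle longer than the three access words is
comparable with the middle word; according to the outcome, the middle word and one neighbour lie on
the same side of it (`exists_cycle_of_alternating`). Shortening the access words first gives the
bound. -/

namespace WheelerLang

universe u v

/-! ### Co-lexicographic order and common suffixes. -/

section Colex

variable {α : Type u} [LinearOrder α]

theorem colexLT_iff_reverse_lt {x y : List α} : ColexLT x y ↔ x.reverse < y.reverse := Iff.rfl

theorem ColexLT.trans {x y z : List α} (h : ColexLT x y) (h' : ColexLT y z) : ColexLT x z := by
  rw [colexLT_iff_reverse_lt] at *
  exact lt_trans h h'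

theorem ColexLT.irrefl (x : List α) : ¬ ColexLT x x := by
  rw [colexLT_iff_reverse_lt]
  exact lt_irrefl _

theorem colexLT_trichotomy (x y : List α) : ColexLT x y ∨ x = y ∨ ColexLT y x := by
  simp only [colexLT_iff_reverse_lt]
  rcases lt_trichotomy x.reverse y.reverse with h | h | h
  · exact Or.inl h
  · exact Or.inr (Or.inl (List.reverse_injective h))
  · exact Or.inr (Or.inr h)

theorem not_colexLT_nil (x : List α) : ¬ ColexLT x [] := by
  simp [ColexLT]

theorem colexLT_nil_concat (x : List α) (a : α) : ColexLT [] (x ++ [a]) := by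
  simp [ColexLT]

theorem colexLT_concat {x y : List α} {a b : α} :
    ColexLT (x ++ [a]) (y ++ [b]) ↔ a < b ∨ a = b ∧ ColexLT x y := by
  simp only [ColexLT, List.reverse_append, List.reverse_cons, List.reverse_nil, List.nil_append,
    List.singleton_append]
  exact List.cons_lt_cons_iff

theorem colexLT_append_right {x y : List α} (t : List α) :
    ColexLT (x ++ t) (y ++ t) ↔ ColexLT x y := by
  induction t using List.reverseRecOn with
  | nil => simp
  | append_singleton t a ih =>
    rw [← List.append_assoc, ← List.append_assoc, colexLT_concat, ih]
    simp

theorem ColexLT.append_left {x y : List α} (h : ColexLT x y) (t : List α) :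
    ColexLT x (t ++ y) := by
  unfold ColexLT at *
  rw [List.reverse_append]
  exact List.Lex.append_right _ _ h

/-- The longer word `x` is not a suffix of `y`, so the order is decided by a mismatch of letters,
which prepending does not affect. -/
theorem ColexLT.append_left_of_length_lt {x y : List α} (h : ColexLT x y)
    (hl : y.length < x.length) (t : List α) : ColexLT (t ++ x) y := by
  induction x using List.reverseRecOn generalizing y with
  | nil => simp at hl
  | append_singleton x a ih =>
    rcases List.eq_nil_or_concat y with rfl | ⟨y, b, rfl⟩
    · exact absurd h (not_colexLT_nil _)
    · rw [← List.append_assoc]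
      rw [List.concat_eq_append] at *
      rw [colexLT_concat] at *
      refine h.imp_right fun h => ⟨h.1, ih h.2 ?_⟩
      simpa using hl

/-- A word between two words with suffix `t` has suffix `t`. -/
theorem exists_eq_append_of_colexLT {x y z t : List α} (h : ColexLT (x ++ t) z)
    (h' : ColexLT z (y ++ t)) : ∃ w, z = w ++ t := by
  induction t using List.reverseRecOn generalizing z with
  | nil => exact ⟨z, by simp⟩
  | append_singleton t a ih =>
    rw [← List.append_assoc] at h h'
    rcases List.eq_nil_or_concat z with rfl | ⟨z, b, rfl⟩
    · exact absurd h (not_colexLT_nil _)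
    · rw [List.concat_eq_append] at *
      rw [colexLT_concat] at h h'
      rcases h with h | ⟨rfl, h⟩
      · rcases h' with h' | ⟨rfl, h'⟩
        · exact absurd h h'.asymm
        · exact absurd h (lt_irrefl _)
      · rcases h' with h' | ⟨-, h'⟩
        · exact absurd h' (lt_irrefl _)
        · obtain ⟨w, rfl⟩ := ih h h'
          exact ⟨w, by simp⟩

/-- `x` precedes `y` already on account of their last letters. -/
def LastLT (x y : List α) : Prop :=
  ∀ x' y' : List α, x'.getLast? = x.getLast? → y'.getLast? = y.getLast? → ColexLT x' y'

theorem lastLT_nil_concat (y : List α) (b : α) : LastLT [] (y ++ [b]) := by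
  intro x' y' hx hy
  have : x' = [] := by simpa using hx
  subst this
  rcases List.eq_nil_or_concat y' with rfl | ⟨y', c, rfl⟩
  · simp at hy
  · rw [List.concat_eq_append]
    exact colexLT_nil_concat _ _

theorem lastLT_concat (x y : List α) {a b : α} (h : a < b) : LastLT (x ++ [a]) (y ++ [b]) := by
  intro x' y' hx hy
  rcases List.eq_nil_or_concat x' with rfl | ⟨x', c, rfl⟩
  · simp at hx
  rcases List.eq_nil_or_concat y' with rfl | ⟨y', d, rfl⟩
  · simp at hy
  rw [List.concat_eq_append] at *
  rw [List.concat_eq_append] at *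
  simp only [List.getLast?_append, List.getLast?_singleton, Option.some_or, Option.some.injEq]
    at hx hy
  subst hx hy
  exact colexLT_concat.2 (Or.inl h)

theorem ColexLT.exists_lastLT {x y : List α} (h : ColexLT x y) :
    ∃ x₀ y₀ t, x = x₀ ++ t ∧ y = y₀ ++ t ∧ LastLT x₀ y₀ := by
  induction y using List.reverseRecOn generalizing x with
  | nil => exact absurd h (not_colexLT_nil _)
  | append_singleton y b ih =>
    rcases List.eq_nil_or_concat x with rfl | ⟨x, a, rfl⟩
    · exact ⟨[], y ++ [b], [], by simp, by simp, lastLT_nil_concat _ _⟩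
    rw [List.concat_eq_append] at *
    rcases colexLT_concat.1 h with hab | ⟨rfl, hxy⟩
    · exact ⟨x ++ [a], y ++ [b], [], by simp, by simp, lastLT_concat _ _ hab⟩
    · obtain ⟨x₀, y₀, t, rfl, rfl, h₀⟩ := ih hxy
      exact ⟨x₀, y₀, t ++ [a], by simp, by simp, h₀⟩

/-- Once the longest common suffix of all three words is removed, the middle word differs from a
neighbour at the very end. -/
theorem ColexLT.exists_lastLT_three {x y z : List α} (h : ColexLT x y) (h' : ColexLT y z) :
    ∃ x₀ y₀ z₀ t, x = x₀ ++ t ∧ y = y₀ ++ t ∧ z = z₀ ++ t ∧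
      ColexLT x₀ y₀ ∧ ColexLT y₀ z₀ ∧ (LastLT x₀ y₀ ∨ LastLT y₀ z₀) := by
  induction y using List.reverseRecOn generalizing x z with
  | nil => exact absurd h (not_colexLT_nil _)
  | append_singleton y b ih =>
    rcases List.eq_nil_or_concat x with rfl | ⟨x, a, rfl⟩
    · exact ⟨[], y ++ [b], z, [], by simp, by simp, by simp, h, h', .inl (lastLT_nil_concat _ _)⟩
    rcases List.eq_nil_or_concat z with rfl | ⟨z, c, rfl⟩
    · exact absurd h' (not_colexLT_nil _)
    rw [List.concat_eq_append] at *
    rw [List.concat_eq_append] at *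
    rcases colexLT_concat.1 h with hab | ⟨rfl, hxy⟩
    · exact ⟨_, _, _, [], by simp, by simp, by simp, h, h', .inl (lastLT_concat _ _ hab)⟩
    rcases colexLT_concat.1 h' with hbc | ⟨rfl, hyz⟩
    · exact ⟨_, _, _, [], by simp, by simp, by simp, h, h', .inr (lastLT_concat _ _ hbc)⟩
    · obtain ⟨x₀, y₀, z₀, t, rfl, rfl, rfl, h₀⟩ := ih hxy hyz
      exact ⟨x₀, y₀, z₀, t ++ [a], by simp, by simp, by simp, h₀⟩

end Colex

/-! ### Runs, pumping and shortening of words. -/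

section Runs

variable {α : Type u} {S : Type v}

theorem mem_evalFrom_nil {A : NFA α S} {p q : S} : q ∈ A.evalFrom {p} [] ↔ q = p := by
  simp

theorem mem_evalFrom_append {A : NFA α S} {p q : S} {x y : List α} :
    q ∈ A.evalFrom {p} (x ++ y) ↔ ∃ r, r ∈ A.evalFrom {p} x ∧ q ∈ A.evalFrom {r} y := by
  rw [NFA.evalFrom_append, NFA.mem_evalFrom_iff_exists]

theorem mem_evalFrom_cons {A : NFA α S} {p q : S} {a : α} {y : List α} :
    q ∈ A.evalFrom {p} (a :: y) ↔ ∃ r, r ∈ A.step p a ∧ q ∈ A.evalFrom {r} y := by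
  rw [NFA.evalFrom_cons, NFA.stepSet_singleton, NFA.mem_evalFrom_iff_exists]

theorem mem_evalFrom_concat {A : NFA α S} {p q : S} {x : List α} {a : α} :
    q ∈ A.evalFrom {p} (x ++ [a]) ↔ ∃ r, r ∈ A.evalFrom {p} x ∧ q ∈ A.step r a := by
  rw [NFA.evalFrom_append, NFA.evalFrom_singleton, NFA.mem_stepSet]

theorem eq_of_mem_evalFrom {A : NFA α S} (hA : ∀ q a, (A.step q a).Subsingleton) {p q r : S}
    {x : List α} (hq : q ∈ A.evalFrom {p} x) (hr : r ∈ A.evalFrom {p} x) : q = r := by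
  induction x generalizing p with
  | nil => rw [mem_evalFrom_nil] at hq hr; rw [hq, hr]
  | cons a x ih =>
    rw [mem_evalFrom_cons] at hq hr
    obtain ⟨q', hq', hq⟩ := hq
    obtain ⟨r', hr', hr⟩ := hr
    obtain rfl := hA _ _ hq' hr'
    exact ih hq hr

theorem mem_evalFrom_flatten_replicate {A : NFA α S} {p : S} {x : List α}
    (h : p ∈ A.evalFrom {p} x) (k : ℕ) : p ∈ A.evalFrom {p} (List.replicate k x).flatten := by
  induction k with
  | zero => simp
  | succ k ih =>
    rw [List.replicate_succ, List.flatten_cons]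
    exact mem_evalFrom_append.2 ⟨p, h, ih⟩

/-- The automaton running `A` and `B` on the same word. -/
def prodNFA {R : Type*} (A : NFA α S) (B : NFA α R) : NFA α (S × R) where
  step p a := {q | q.1 ∈ A.step p.1 a ∧ q.2 ∈ B.step p.2 a}
  start := {q | q.1 ∈ A.start ∧ q.2 ∈ B.start}
  accept := {q | q.1 ∈ A.accept ∧ q.2 ∈ B.accept}

theorem mem_prodNFA_evalFrom {R : Type*} {A : NFA α S} {B : NFA α R} {p q : S × R}
    {x : List α} :
    q ∈ (prodNFA A B).evalFrom {p} x ↔ q.1 ∈ A.evalFrom {p.1} x ∧ q.2 ∈ B.evalFrom {p.2} x := by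
  induction x generalizing p with
  | nil => simp only [mem_evalFrom_nil]; exact Prod.ext_iff
  | cons a x ih =>
    simp only [mem_evalFrom_cons, ih]
    constructor
    · rintro ⟨r, hr, h₁, h₂⟩
      exact ⟨⟨_, hr.1, h₁⟩, ⟨_, hr.2, h₂⟩⟩
    · rintro ⟨⟨r₁, hr₁, h₁⟩, ⟨r₂, hr₂, h₂⟩⟩
      exact ⟨(r₁, r₂), ⟨hr₁, hr₂⟩, h₁, h₂⟩

theorem exists_run_of_mem_evalFrom {A : NFA α S} {p q : S} {x : List α}
    (h : q ∈ A.evalFrom {p} x) :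
    ∃ g : ℕ → S, g 0 = p ∧ g x.length = q ∧
      ∀ i j, i ≤ j → j ≤ x.length → g j ∈ A.evalFrom {g i} ((x.take j).drop i) := by
  induction x using List.reverseRecOn generalizing q with
  | nil =>
    rw [mem_evalFrom_nil] at h
    exact ⟨fun _ => p, rfl, h.symm, fun i j _ _ => by simp⟩
  | append_singleton x a ih =>
    obtain ⟨r, hr, hq⟩ := mem_evalFrom_concat.1 h
    obtain ⟨g, hg0, hg1, hg⟩ := ih hr
    refine ⟨fun i => if i ≤ x.length then g i else q, by simp [hg0], by simp, ?_⟩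
    intro i j hij hj
    rw [List.length_append, List.length_singleton] at hj
    rcases Nat.lt_or_ge x.length j with hlt | hle
    · obtain rfl : j = x.length + 1 := by omega
      rw [List.take_of_length_le (by simp)]
      rcases Nat.lt_or_ge x.length i with hi | hi
      · obtain rfl : i = x.length + 1 := by omega
        simp
      · simp only [hi, if_true, hlt.not_ge, if_false]
        rw [List.drop_append_of_le_length hi]
        refine mem_evalFrom_concat.2 ⟨r, ?_, hq⟩
        have := hg i x.length hi le_rfl
        rwa [List.take_length, hg1] at this
    · simp only [hle, hij.trans hle, if_true]
      rw [List.take_append_of_le_length hle]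
      exact hg i j hij hle

/-- A run of length at least the number of states passes through a cycle early. -/
theorem exists_cycle_of_card_le_length [Finite S] {A : NFA α S} {p q : S} {x : List α}
    (h : q ∈ A.evalFrom {p} x) (hx : Nat.card S ≤ x.length) :
    ∃ x₁ x₂ x₃ r, x = x₁ ++ x₂ ++ x₃ ∧ x₂ ≠ [] ∧ x₁.length + x₂.length ≤ Nat.card S ∧
      r ∈ A.evalFrom {p} x₁ ∧ r ∈ A.evalFrom {r} x₂ ∧ q ∈ A.evalFrom {r} x₃ := by
  obtain ⟨g, hg0, hg1, hg⟩ := exists_run_of_mem_evalFrom h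
  have key : ∃ i j, i < j ∧ j ≤ Nat.card S ∧ g i = g j := by
    by_contra! hne
    have hinj : Function.Injective fun i : Fin (Nat.card S + 1) => g i := by
      intro i j hij
      rcases lt_trichotomy i j with hlt | rfl | hlt
      · exact absurd hij (hne i j hlt (by omega))
      · rfl
      · exact absurd hij.symm (hne j i hlt (by omega))
    have := Nat.card_le_card_of_injective _ hinj
    simp at this
  obtain ⟨i, j, hij, hj, hgij⟩ := key
  have hjx := hj.trans hx
  refine ⟨x.take i, (x.take j).drop i, x.drop j, g i, ?_, ?_, ?_, ?_, ?_, ?_⟩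
  · have : x.take i = (x.take j).take i := by rw [List.take_take, min_eq_left hij.le]
    rw [this, List.take_append_drop, List.take_append_drop]
  · intro h0
    have := congrArg List.length h0
    simp at this
    omega
  · simp; omega
  · have := hg 0 i (Nat.zero_le _) (by omega)
    rwa [hg0, List.drop_zero] at this
  · have := hg i j hij.le hjx
    rwa [← hgij] at this
  · have := hg j x.length hjx le_rfl
    rwa [List.take_length, hg1, ← hgij] at this

theorem exists_length_lt_card [Finite S] {A : NFA α S} {p q : S} {x : List α}
    (h : q ∈ A.evalFrom {p} x) :
    ∃ y : List α, q ∈ A.evalFrom {p} y ∧ y.length < Nat.card S := by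
  induction hn : x.length using Nat.strong_induction_on generalizing x with
  | _ n ih =>
    subst hn
    rcases Nat.lt_or_ge x.length (Nat.card S) with hlt | hge
    · exact ⟨x, h, hlt⟩
    · obtain ⟨x₁, x₂, x₃, r, rfl, hne, -, h₁, -, h₃⟩ := exists_cycle_of_card_le_length h hge
      refine ih (x₁ ++ x₃).length ?_ (mem_evalFrom_append.2 ⟨r, h₁, h₃⟩) rfl
      have := List.length_pos_of_ne_nil hne
      simp; omega

theorem exists_length_le_card_getLast [Finite S] {A : NFA α S} {p q : S} {x : List α}
    (h : q ∈ A.evalFrom {p} x) :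
    ∃ y : List α, q ∈ A.evalFrom {p} y ∧ y.length ≤ Nat.card S ∧ y.getLast? = x.getLast? := by
  rcases List.eq_nil_or_concat x with rfl | ⟨x, a, rfl⟩
  · exact ⟨[], h, by simp, rfl⟩
  · rw [List.concat_eq_append] at *
    obtain ⟨r, hr, hq⟩ := mem_evalFrom_concat.1 h
    obtain ⟨y, hy, hlen⟩ := exists_length_lt_card hr
    exact ⟨y ++ [a], mem_evalFrom_concat.2 ⟨r, hy, hq⟩, by simp; omega, by simp⟩

/-- Two words can be shortened simultaneously, keeping their order, their last letters and the
states they lead to. -/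
theorem ColexLT.exists_shorter [LinearOrder α] [Finite S] {A : NFA α S} {s p q : S}
    {x y : List α} (h : ColexLT x y) (hx : p ∈ A.evalFrom {s} x) (hy : q ∈ A.evalFrom {s} y) :
    ∃ x' y' : List α, ColexLT x' y' ∧ p ∈ A.evalFrom {s} x' ∧ q ∈ A.evalFrom {s} y' ∧
      x'.getLast? = x.getLast? ∧ y'.getLast? = y.getLast? ∧
      x'.length ≤ Nat.card S + Nat.card S ^ 2 ∧ y'.length ≤ Nat.card S + Nat.card S ^ 2 := by
  obtain ⟨x₀, y₀, t, rfl, rfl, h₀⟩ := h.exists_lastLT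
  obtain ⟨p₀, hp₀, hp⟩ := mem_evalFrom_append.1 hx
  obtain ⟨q₀, hq₀, hq⟩ := mem_evalFrom_append.1 hy
  obtain ⟨x₁, hx₁, hxl, hxe⟩ := exists_length_le_card_getLast hp₀
  obtain ⟨y₁, hy₁, hyl, hye⟩ := exists_length_le_card_getLast hq₀
  have h₁ := h₀ _ _ hxe hye
  -- The common suffix must stay common, so it is shortened in the product automaton; this costs the
  -- square.
  have ht : (p, q) ∈ (prodNFA A A).evalFrom {(p₀, q₀)} t := mem_prodNFA_evalFrom.2 ⟨hp, hq⟩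
  obtain ⟨t₁, ht₁, htl, hte⟩ := exists_length_le_card_getLast ht
  obtain ⟨hp', hq'⟩ := mem_prodNFA_evalFrom.1 ht₁
  have hcard : Nat.card (S × S) = Nat.card S ^ 2 := by rw [Nat.card_prod, sq]
  rw [hcard] at htl
  refine ⟨x₁ ++ t₁, y₁ ++ t₁, (colexLT_append_right _).2 h₁,
    mem_evalFrom_append.2 ⟨_, hx₁, hp'⟩, mem_evalFrom_append.2 ⟨_, hy₁, hq'⟩, ?_, ?_, ?_, ?_⟩
  · rw [List.getLast?_append, List.getLast?_append, hxe, hte]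
  · rw [List.getLast?_append, List.getLast?_append, hye, hte]
  · simp; omega
  · simp; omega

end Runs

/-! ### Convexity in Wheeler automata. -/

section OfWheeler

variable {α : Type u} [LinearOrder α] {Q : Type v} [LinearOrder Q]

/-- Axiom (ii) gives only a weak inequality; in case of equality the common state is reached by both
words, and this alternative persists along further letters. -/
theorem IsWheelerNFA.lt_or_mem_of_colexLT {A : NFA α Q} {s : Q} (hA : IsWheelerNFA A s)
    {x y : List α} (h : ColexLT x y) {p q : Q} (hp : p ∈ A.evalFrom {s} x)
    (hq : q ∈ A.evalFrom {s} y) :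
    p < q ∨ p ∈ A.evalFrom {s} y ∧ q ∈ A.evalFrom {s} x := by
  induction y using List.reverseRecOn generalizing x p q with
  | nil => exact absurd h (not_colexLT_nil _)
  | append_singleton y b ih =>
    obtain ⟨q', hq', hqs⟩ := mem_evalFrom_concat.1 hq
    rcases List.eq_nil_or_concat x with rfl | ⟨x, a, rfl⟩
    · rw [mem_evalFrom_nil] at hp
      subst hp
      refine .inl (lt_of_le_of_ne (hA.start_le q) ?_)
      rintro rfl
      exact hA.noIncoming _ _ hqs
    · rw [List.concat_eq_append] at *
      obtain ⟨p', hp', hps⟩ := mem_evalFrom_concat.1 hp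
      rcases colexLT_concat.1 h with hab | ⟨rfl, hxy⟩
      · exact .inl (hA.lt_of_label_lt _ _ _ _ _ _ hps hqs hab)
      · rcases ih hxy hp' hq' with hlt | ⟨h₁, h₂⟩
        · rcases (hA.le_of_source_lt _ _ _ _ _ hps hqs hlt).lt_or_eq with hlt | rfl
          · exact .inl hlt
          · exact .inr ⟨hq, hp⟩
        · exact .inr ⟨mem_evalFrom_concat.2 ⟨_, h₁, hps⟩, mem_evalFrom_concat.2 ⟨_, h₂, hqs⟩⟩

/-- In a Wheeler automaton, the words leading to a given set of states are convex. -/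
theorem IsWheelerNFA.evalFrom_eq_of_colexLT {A : NFA α Q} {s : Q} (hA : IsWheelerNFA A s)
    {x y z : List α} (h : (ColexLT x y ∧ ColexLT y z) ∨ (ColexLT z y ∧ ColexLT y x))
    (hx : (A.evalFrom {s} x).Nonempty) (hy : (A.evalFrom {s} y).Nonempty)
    (hxz : A.evalFrom {s} x = A.evalFrom {s} z) : A.evalFrom {s} x = A.evalFrom {s} y := by
  -- `p` is reached on both sides of `y`, so `p < q` and `q < p` cannot both hold; one comparison
  -- yields the memberships.
  have key : ∀ p ∈ A.evalFrom {s} x, ∀ q ∈ A.evalFrom {s} y,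
      p ∈ A.evalFrom {s} y ∧ q ∈ A.evalFrom {s} x := by
    intro p hp q hq
    have hp' := hxz ▸ hp
    rcases h with ⟨h₁, h₂⟩ | ⟨h₁, h₂⟩
    · rcases hA.lt_or_mem_of_colexLT h₁ hp hq with hlt | h
      · rcases hA.lt_or_mem_of_colexLT h₂ hq hp' with hlt' | h
        · exact absurd hlt hlt'.asymm
        · exact ⟨h.2, hxz ▸ h.1⟩
      · exact h
    · rcases hA.lt_or_mem_of_colexLT h₁ hp' hq with hlt | h
      · rcases hA.lt_or_mem_of_colexLT h₂ hq hp with hlt' | h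
        · exact absurd hlt hlt'.asymm
        · exact h.symm
      · exact ⟨h.1, hxz ▸ h.2⟩
  obtain ⟨p₀, hp₀⟩ := hx
  obtain ⟨q₀, hq₀⟩ := hy
  exact Set.Subset.antisymm (fun p hp => (key p hp q₀ hq₀).1) fun q hq => (key p₀ hp₀ q hq).2

end OfWheeler

/-! ### Interleaving of pumped words. -/

section Interleaving

variable {α : Type u} [LinearOrder α]

/-- Cancelling the `i` common copies of `c` leaves `x` against a word ending in `c`; hence `y` is
arbitrary. -/
theorem colexLT_append_flatten_replicate {x y c : List α} (h : ColexLT x c) {i j : ℕ}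
    (hij : i < j) :
    ColexLT (x ++ (List.replicate i c).flatten) (y ++ (List.replicate j c).flatten) := by
  obtain ⟨k, rfl⟩ := Nat.exists_eq_add_of_lt hij
  have : (List.replicate (i + k + 1) c).flatten =
      (List.replicate k c).flatten ++ c ++ (List.replicate i c).flatten := by
    rw [show i + k + 1 = k + (1 + i) by omega, List.replicate_add, List.replicate_add]
    simp
  rw [this, ← List.append_assoc, ← List.append_assoc, colexLT_append_right]
  exact h.append_left _

theorem colexLT_append_flatten_replicate_of_length_lt {x y c : List α} (h : ColexLT c x)
    (hl : x.length < c.length) {i j : ℕ} (hij : i < j) :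
    ColexLT (y ++ (List.replicate j c).flatten) (x ++ (List.replicate i c).flatten) := by
  obtain ⟨k, rfl⟩ := Nat.exists_eq_add_of_lt hij
  have : (List.replicate (i + k + 1) c).flatten =
      (List.replicate k c).flatten ++ c ++ (List.replicate i c).flatten := by
    rw [show i + k + 1 = k + (1 + i) by omega, List.replicate_add, List.replicate_add]
    simp
  rw [this, ← List.append_assoc, ← List.append_assoc, colexLT_append_right]
  exact h.append_left_of_length_lt hl _

/-- In a Wheeler language, two words pumped by the same larger (or the same smaller) word
eventually have a common right context. -/
theorem IsWheelerLanguage.exists_same_context {L : Language α} (hL : IsWheelerLanguage L)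
    {x y c : List α} (hx : ∀ i, ∃ z, x ++ (List.replicate i c).flatten ++ z ∈ L)
    (hy : ∀ i, ∃ z, y ++ (List.replicate i c).flatten ++ z ∈ L)
    (h : (ColexLT x c ∧ ColexLT y c) ∨ (ColexLT c x ∧ ColexLT c y))
    (hxl : x.length < c.length) (hyl : y.length < c.length) :
    ∃ i j, ∀ z, x ++ (List.replicate i c).flatten ++ z ∈ L ↔
      y ++ (List.replicate j c).flatten ++ z ∈ L := by
  obtain ⟨T, _, _, B, t, hB, rfl⟩ := hL
  have hmem : ∀ a, a ∈ B.accepts ↔ ∃ f ∈ B.accept, f ∈ B.evalFrom {t} a := by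
    intro a
    rw [NFA.mem_accepts, hB.trim.start_eq]
  have hne : ∀ a b, a ++ b ∈ B.accepts → (B.evalFrom {t} a).Nonempty := by
    intro a b hab
    obtain ⟨f, -, hf⟩ := (hmem _).1 hab
    obtain ⟨r, hr, -⟩ := mem_evalFrom_append.1 hf
    exact ⟨r, hr⟩
  -- Even exponents leave room for the odd exponent `2 * i + 1` strictly between two repetitions.
  obtain ⟨i, j, hij, heq⟩ : ∃ i j, i < j ∧
      B.evalFrom {t} (x ++ (List.replicate (2 * i) c).flatten) =
        B.evalFrom {t} (x ++ (List.replicate (2 * j) c).flatten) := by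
    obtain ⟨i, j, hne, heq⟩ := Finite.exists_ne_map_eq_of_infinite
      fun i : ℕ => B.evalFrom {t} (x ++ (List.replicate (2 * i) c).flatten)
    rcases lt_or_gt_of_ne hne with h | h
    · exact ⟨i, j, h, heq⟩
    · exact ⟨j, i, h, heq.symm⟩
  refine ⟨2 * i, 2 * i + 1, fun z => ?_⟩
  obtain ⟨z₁, hz₁⟩ := hx (2 * i)
  obtain ⟨z₂, hz₂⟩ := hy (2 * i + 1)
  have hmid := hB.evalFrom_eq_of_colexLT
    (y := y ++ (List.replicate (2 * i + 1) c).flatten) ?_ (hne _ _ hz₁) (hne _ _ hz₂) heq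
  · rw [hmem, hmem, NFA.evalFrom_append, hmid, ← NFA.evalFrom_append]
  · rcases h with ⟨h₁, h₂⟩ | ⟨h₁, h₂⟩
    · exact .inl ⟨colexLT_append_flatten_replicate h₁ (by omega),
        colexLT_append_flatten_replicate h₂ (by omega)⟩
    · exact .inr ⟨colexLT_append_flatten_replicate_of_length_lt h₂ hyl (by omega),
        colexLT_append_flatten_replicate_of_length_lt h₁ hxl (by omega)⟩

end Interleaving

/-! ### Quotients and minimality. -/

section Minimality

variable {α : Type u} {Q : Type v}

/-- The quotient of an automaton by an equivalence relation on its states. -/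
def quotientNFA (A : NFA α Q) (r : Setoid Q) : NFA α (Quotient r) where
  step c a := {d | ∃ p q, Quotient.mk r p = c ∧ Quotient.mk r q = d ∧ q ∈ A.step p a}
  start := Quotient.mk r '' A.start
  accept := Quotient.mk r '' A.accept

/-- Automata may be incomplete; the transition from `p'` exists because `q` is coreachable. -/
theorem IsDFAFor.exists_step_of_acceptsFrom_eq {A : NFA α Q} {s : Q} {L : Language α}
    (hA : IsDFAFor A s L) {p p' q : Q} {a : α} (h : A.acceptsFrom {p} = A.acceptsFrom {p'})
    (hq : q ∈ A.step p a) :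
    ∃ q' ∈ A.step p' a, A.acceptsFrom {q} = A.acceptsFrom {q'} := by
  have key : ∀ r r' z, r' ∈ A.step r a →
      (a :: z ∈ A.acceptsFrom {r} ↔ z ∈ A.acceptsFrom {r'}) := by
    intro r r' z hr'
    rw [NFA.cons_mem_acceptsFrom, NFA.stepSet_singleton,
      Set.Subsingleton.eq_singleton_of_mem (hA.deterministic r a) hr']
  obtain ⟨z, f, hf, hz⟩ := hA.trim.coreachable q
  have hz' : a :: z ∈ A.acceptsFrom {p'} :=
    h ▸ (key p q z hq).2 (NFA.mem_acceptsFrom.2 ⟨f, hf, hz⟩)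
  obtain ⟨f', -, hf'⟩ := NFA.mem_acceptsFrom.1 hz'
  obtain ⟨q', hq', -⟩ := mem_evalFrom_cons.1 hf'
  refine ⟨q', hq', ?_⟩
  ext z
  rw [← key p q z hq, ← key p' q' z hq', h]

theorem IsDFAFor.quotientNFA {A : NFA α Q} {s : Q} {L : Language α} (hA : IsDFAFor A s L)
    (r : Setoid Q) (hacc : ∀ p q, r p q → A.acceptsFrom {p} = A.acceptsFrom {q})
    (hstep : ∀ p p' q q' a, r p p' → q ∈ A.step p a → q' ∈ A.step p' a →
      A.acceptsFrom {q} = A.acceptsFrom {q'} → r q q') :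
    IsDFAFor (quotientNFA A r) (Quotient.mk r s) L := by
  have hev : ∀ (x : List α) (p : Q) (d : Quotient r),
      d ∈ (WheelerLang.quotientNFA A r).evalFrom {Quotient.mk r p} x ↔
        ∃ q ∈ A.evalFrom {p} x, Quotient.mk r q = d := by
    intro x
    induction x with
    | nil => intro p d; simp [eq_comm]
    | cons a x ih =>
      intro p d
      rw [mem_evalFrom_cons]
      constructor
      · rintro ⟨_, ⟨p', q', hp', rfl, hq'⟩, hd⟩
        have hr : r p' p := Quotient.exact hp'
        obtain ⟨q, hq, hqq⟩ := hA.exists_step_of_acceptsFrom_eq (hacc _ _ hr) hq'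
        have : Quotient.mk r q' = Quotient.mk r q :=
          Quotient.sound (hstep _ _ _ _ _ hr hq' hq hqq)
        rw [this, ih] at hd
        obtain ⟨q₁, hq₁, rfl⟩ := hd
        exact ⟨q₁, mem_evalFrom_cons.2 ⟨q, hq, hq₁⟩, rfl⟩
      · rintro ⟨q, hq, rfl⟩
        obtain ⟨q₁, hq₁, hq⟩ := mem_evalFrom_cons.1 hq
        exact ⟨Quotient.mk r q₁, ⟨p, q₁, rfl, rfl, hq₁⟩, (ih _ _).2 ⟨q, hq, rfl⟩⟩
  have hstart : (WheelerLang.quotientNFA A r).start = {Quotient.mk r s} := by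
    simp [WheelerLang.quotientNFA, hA.trim.start_eq]
  refine ⟨⟨hstart, ?_, ?_⟩, ?_, ?_⟩
  · intro d
    obtain ⟨q, rfl⟩ := Quotient.exists_rep d
    obtain ⟨x, hx⟩ := hA.trim.reachable q
    exact ⟨x, (hev _ _ _).2 ⟨q, hx, rfl⟩⟩
  · intro d
    obtain ⟨q, rfl⟩ := Quotient.exists_rep d
    obtain ⟨x, f, hf, hx⟩ := hA.trim.coreachable q
    exact ⟨x, _, ⟨f, hf, rfl⟩, (hev _ _ _).2 ⟨f, hx, rfl⟩⟩
  · rintro c a _ ⟨p, q, rfl, rfl, hq⟩ _ ⟨p', q', hp', rfl, hq'⟩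
    have hr : r p' p := Quotient.exact hp'
    obtain ⟨q₁, hq₁, hqq⟩ := hA.exists_step_of_acceptsFrom_eq (hacc _ _ hr) hq'
    obtain rfl := hA.deterministic _ _ hq hq₁
    exact (Quotient.sound (hstep _ _ _ _ _ hr hq' hq hqq)).symm
  · rw [← hA.accepts_eq]
    ext x
    rw [NFA.mem_accepts, NFA.mem_accepts, hstart, hA.trim.start_eq]
    constructor
    · rintro ⟨_, ⟨f, hf, rfl⟩, hx⟩
      obtain ⟨q, hq, hqf⟩ := (hev _ _ _).1 hx
      have : [] ∈ A.acceptsFrom {q} := by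
        rw [hacc q f (Quotient.exact hqf), NFA.nil_mem_acceptsFrom]
        exact ⟨f, rfl, hf⟩
      rw [NFA.nil_mem_acceptsFrom] at this
      obtain ⟨q', rfl, hq'⟩ := this
      exact ⟨_, hq', hq⟩
    · rintro ⟨f, hf, hx⟩
      exact ⟨_, ⟨f, hf, rfl⟩, (hev _ _ _).2 ⟨f, hx, rfl⟩⟩

theorem card_quotient_lt [Finite Q] (r : Setoid Q) {p q : Q} (h : r p q) (hne : p ≠ q) :
    Nat.card (Quotient r) < Nat.card Q := by
  refine lt_of_not_ge fun hle => hne ?_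
  have hs : Function.Surjective (Quotient.mk r) := Quotient.exists_rep
  exact (Function.Surjective.bijective_of_nat_card_le hs hle).1 (Quotient.sound h)

theorem IsMinimumDFA.eq_of_acceptsFrom_eq [Finite Q] {A : NFA α Q} {s : Q} {L : Language α}
    (hA : IsMinimumDFA A s L) {p q : Q} (h : A.acceptsFrom {p} = A.acceptsFrom {q}) : p = q := by
  by_contra hne
  let r : Setoid Q := Setoid.ker fun q => A.acceptsFrom {q}
  have hr : ∀ p q, r p q ↔ A.acceptsFrom {p} = A.acceptsFrom {q} := fun _ _ => Iff.rfl
  exact (hA.card_le _ _ _ (hA.isDFA.quotientNFA r (fun p q h => (hr p q).1 h)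
    fun _ _ _ _ _ _ _ _ h => (hr _ _).2 h)).not_gt (card_quotient_lt r ((hr _ _).2 h) hne)

/-- The quotient keeps `s` alone in its class, since merging it with another state could create a
transition into the initial state. -/
theorem IsMinimumRootedDFA.eq_of_acceptsFrom_eq [Finite Q] {A : NFA α Q} {s : Q}
    {L : Language α} (hA : IsMinimumRootedDFA A s L) {p q : Q} (hp : p ≠ s) (hq : q ≠ s)
    (h : A.acceptsFrom {p} = A.acceptsFrom {q}) : p = q := by
  by_contra hne
  let r : Setoid Q := Setoid.ker fun q => (A.acceptsFrom {q}, q = s)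
  have hr : ∀ p q, r p q ↔ A.acceptsFrom {p} = A.acceptsFrom {q} ∧ (p = s) = (q = s) :=
    fun _ _ => Prod.ext_iff
  refine (hA.card_le _ _ _ (hA.isDFA.quotientNFA r (fun p q h => ((hr p q).1 h).1) ?_) ?_).not_gt
    (card_quotient_lt r ((hr p q).2 ⟨h, by simp [hp, hq]⟩) hne)
  · intro _ _ q q' a _ hq hq' h
    have h₁ : q ≠ s := fun h => hA.noIncoming _ _ (h ▸ hq)
    have h₂ : q' ≠ s := fun h => hA.noIncoming _ _ (h ▸ hq')
    exact (hr _ _).2 ⟨h, by simp [h₁, h₂]⟩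
  · rintro c a ⟨p, q, -, hqs, hq⟩
    have : (q = s) = (s = s) := ((hr _ _).1 (Quotient.exact hqs)).2
    have hq' : q = s := by rw [this]
    exact hA.noIncoming _ _ (hq' ▸ hq)

theorem NoIncoming.ne_of_mem_evalFrom {A : NFA α Q} {s : Q} (hA : NoIncoming A s) {p q : Q}
    {x : List α} (hx : x ≠ []) (h : q ∈ A.evalFrom {p} x) : q ≠ s := by
  obtain ⟨y, a, rfl⟩ := (List.eq_nil_or_concat x).resolve_left hx
  rw [List.concat_eq_append] at h
  obtain ⟨r, -, hr⟩ := mem_evalFrom_concat.1 h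
  rintro rfl
  exact hA _ _ hr

end Minimality

theorem IsDFAFor.acceptsFrom_eq_of_isWheelerLanguage {α : Type u} [LinearOrder α] {Q : Type v}
    {A : NFA α Q} {s : Q} {L : Language α} (hA : IsDFAFor A s L) (hL : IsWheelerLanguage L)
    {x y c : List α} {p q : Q} (hx : p ∈ A.evalFrom {s} x) (hy : q ∈ A.evalFrom {s} y)
    (hp : p ∈ A.evalFrom {p} c) (hq : q ∈ A.evalFrom {q} c)
    (h : (ColexLT x c ∧ ColexLT y c) ∨ (ColexLT c x ∧ ColexLT c y))
    (hxl : x.length < c.length) (hyl : y.length < c.length) :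
    A.acceptsFrom {p} = A.acceptsFrom {q} := by
  have key : ∀ (x : List α) (p : Q), p ∈ A.evalFrom {s} x → p ∈ A.evalFrom {p} c → ∀ i z,
      x ++ (List.replicate i c).flatten ++ z ∈ L ↔ z ∈ A.acceptsFrom {p} := by
    intro x p hx hp i z
    have hxi := mem_evalFrom_append.2 ⟨p, hx, mem_evalFrom_flatten_replicate hp i⟩
    rw [← hA.accepts_eq, NFA.accepts_eq_acceptsFrom_start, hA.trim.start_eq,
      NFA.append_mem_acceptsFrom]
    have : A.evalFrom {s} (x ++ (List.replicate i c).flatten) = {p} :=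
      Set.Subsingleton.eq_singleton_of_mem
        (fun _ h₁ _ h₂ => eq_of_mem_evalFrom hA.deterministic h₁ h₂) hxi
    rw [this]
  have hco : ∀ p, ∃ z, z ∈ A.acceptsFrom {p} := fun p =>
    (hA.trim.coreachable p).imp fun _ => NFA.mem_acceptsFrom.2
  obtain ⟨i, j, hij⟩ := hL.exists_same_context (x := x) (y := y) (c := c)
    (fun i => (hco p).imp fun z => (key x p hx hp i z).2)
    (fun i => (hco q).imp fun z => (key y q hy hq i z).2) h hxl hyl
  ext z
  rw [← key x p hx hp i z, hij, key y q hy hq j z]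

theorem eq_append_reverse_take_reverse {α : Type u} (x : List α) (n : ℕ) :
    ∃ y, x = y ++ (x.reverse.take n).reverse := by
  refine ⟨(x.reverse.drop n).reverse, ?_⟩
  rw [← List.reverse_append, List.take_append_drop, List.reverse_reverse]

/-! ### Wheeler automata from convex colourings. -/

section Quotient

variable {α : Type u} [LinearOrder α]

/-- A language is Wheeler if its prefixes can be coloured by finitely many colours such that the
colour classes are convex, the colour of `x ++ [a]` depends only on `a` and the colour of `x`,
and the colour of a word determines its last letter and whether it belongs to the language. -/
theorem isWheelerLanguage_of_convex {L : Language α} {S : Type v} {T : Type} [Finite T]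
    (cl : List α → S) (f : T → S) (hf : Function.Injective f) {P : List α → Prop}
    (hP : ∀ x, P x ↔ ∃ z, x ++ z ∈ L) (hnil : P [])
    (hTP : ∀ t, ∃ x, P x ∧ cl x = f t) (hPT : ∀ x, P x → ∃ t, f t = cl x)
    (hconv : ∀ x y z, P x → P y → P z → ColexLT x y → ColexLT y z → cl x = cl z → cl y = cl x)
    (hcongr : ∀ x y a, P x → P y → cl x = cl y → P (x ++ [a]) →
      P (y ++ [a]) ∧ cl (y ++ [a]) = cl (x ++ [a]))
    (hlast : ∀ x y, cl x = cl y → x.getLast? = y.getLast?)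
    (hacc : ∀ x y, P x → P y → cl x = cl y → x ∈ L → y ∈ L) :
    IsWheelerLanguage L := by
  have hpre : ∀ x z, P (x ++ z) → P x := by
    intro x z h
    obtain ⟨z', hz'⟩ := (hP _).1 h
    exact (hP _).2 ⟨z ++ z', by rwa [← List.append_assoc]⟩
  have hLP : ∀ x ∈ L, P x := fun x hx => (hP _).2 ⟨[], by simpa using hx⟩
  obtain ⟨t₀, ht₀⟩ := hPT [] hnil
  choose rep hrepP hrep using hTP
  have hinj : Function.Injective fun t => (rep t).reverse := by
    intro t t' h
    apply hf
    rw [← hrep t, ← hrep t', List.reverse_injective h]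
  let ord : LinearOrder T := LinearOrder.lift' (fun t => (rep t).reverse) hinj
  have hlt : ∀ t t', t < t' ↔ ColexLT (rep t) (rep t') := fun _ _ => Iff.rfl
  -- Colours are ordered by arbitrary representatives. By convexity this agrees with the order of
  -- all words: an inversion would put a word of one colour between two of the other.
  have hmono : ∀ x y t t', P x → P y → cl x = f t → cl y = f t' → ColexLT x y → t ≤ t' := by
    intro x y t t' hx hy hxt hyt hxy
    by_contra hle
    rw [not_le, hlt] at hle
    have hne : f t ≠ f t' := by
      intro h
      rw [hf h] at hle
      exact ColexLT.irrefl _ hle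
    rcases colexLT_trichotomy (rep t') x with h | h | h
    · refine hne ?_
      rw [← hxt, ← hrep t']
      exact hconv _ _ _ (hrepP _) hx hy h hxy (by rw [hrep, hyt])
    · exact hne (by rw [← hxt, ← h, hrep])
    · refine hne ?_
      rw [← hxt, ← hrep t']
      exact (hconv _ _ _ hx (hrepP _) (hrepP _) h hle (by rw [hrep, hxt])).symm
  have hrefl : ∀ x y t t', P x → P y → cl x = f t → cl y = f t' → t < t' → ColexLT x y := by
    intro x y t t' hx hy hxt hyt h
    rcases colexLT_trichotomy x y with hxy | rfl | hyx
    · exact hxy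
    · exact absurd (hf (hxt.symm.trans hyt)) h.ne
    · exact absurd (hmono _ _ _ _ hy hx hyt hxt hyx) h.not_ge
  let B : NFA α T :=
    { step := fun t a => {t' | ∃ x, P (x ++ [a]) ∧ cl x = f t ∧ cl (x ++ [a]) = f t'}
      start := {t₀}
      accept := {t | ∃ x ∈ L, cl x = f t} }
  have hstep : ∀ t t' a,
      t' ∈ B.step t a ↔ ∃ x, P (x ++ [a]) ∧ cl x = f t ∧ cl (x ++ [a]) = f t' :=
    fun _ _ _ => Iff.rfl
  have hBacc : ∀ t, t ∈ B.accept ↔ ∃ x ∈ L, cl x = f t := fun _ => Iff.rfl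
  have hev : ∀ x t, t ∈ B.evalFrom {t₀} x ↔ P x ∧ cl x = f t := by
    intro x
    induction x using List.reverseRecOn with
    | nil =>
      intro t
      rw [mem_evalFrom_nil, ← ht₀]
      exact ⟨fun h => ⟨hnil, by rw [h]⟩, fun h => (hf h.2).symm⟩
    | append_singleton x a ih =>
      intro t
      simp only [mem_evalFrom_concat, ih, hstep]
      constructor
      · rintro ⟨r, ⟨hx, hxr⟩, y, hy, hyr, hyt⟩
        obtain ⟨h₁, h₂⟩ := hcongr y x a (hpre _ _ hy) hx (hyr.trans hxr.symm) hy
        exact ⟨h₁, h₂.trans hyt⟩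
      · rintro ⟨hx, hxt⟩
        obtain ⟨r, hr⟩ := hPT x (hpre _ _ hx)
        exact ⟨r, ⟨hpre _ _ hx, hr.symm⟩, x, hx, hr.symm, hxt⟩
  have hev' : ∀ z x t t', P (x ++ z) → cl x = f t → cl (x ++ z) = f t' →
      t' ∈ B.evalFrom {t} z := by
    intro z
    induction z with
    | nil =>
      intro x t t' _ ht ht'
      rw [List.append_nil, ht] at ht'
      exact mem_evalFrom_nil.2 (hf ht').symm
    | cons a z ih =>
      intro x t t' hx ht ht'
      have hxa : x ++ a :: z = (x ++ [a]) ++ z := by simp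
      rw [hxa] at hx ht'
      obtain ⟨r, hr⟩ := hPT (x ++ [a]) (hpre _ _ hx)
      exact mem_evalFrom_cons.2
        ⟨r, (hstep _ _ _).2 ⟨x, hpre _ _ hx, ht, hr.symm⟩, ih _ _ _ hx hr.symm ht'⟩
  refine ⟨T, inferInstance, ord, B, t₀, ⟨⟨rfl, ?_, ?_⟩, ?_, ?_, ?_, ?_⟩, ?_⟩
  · exact fun t => ⟨rep t, (hev _ _).2 ⟨hrepP t, hrep t⟩⟩
  · intro t
    obtain ⟨z, hz⟩ := (hP _).1 (hrepP t)
    obtain ⟨t', ht'⟩ := hPT _ (hLP _ hz)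
    exact ⟨z, t', (hBacc _).2 ⟨_, hz, ht'.symm⟩, hev' _ _ _ _ (hLP _ hz) (hrep t) ht'.symm⟩
  · intro t
    rcases List.eq_nil_or_concat (rep t) with h | ⟨y, a, h⟩
    · have := hrep t
      rw [h, ← ht₀] at this
      exact (hf this).le
    · refine hmono [] (rep t) _ _ hnil (hrepP t) ht₀.symm (hrep t) ?_
      rw [h, List.concat_eq_append]
      exact colexLT_nil_concat _ _
  · intro t a h
    obtain ⟨x, -, -, hx⟩ := (hstep _ _ _).1 h
    have := hlast _ _ (hx.trans ht₀)
    simp at this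
  · intro u₁ u₂ v₁ v₂ a₁ a₂ h₁ h₂ ha
    obtain ⟨x₁, hx₁, -, hv₁⟩ := (hstep _ _ _).1 h₁
    obtain ⟨x₂, hx₂, -, hv₂⟩ := (hstep _ _ _).1 h₂
    refine lt_of_le_of_ne
      (hmono _ _ _ _ hx₁ hx₂ hv₁ hv₂ (colexLT_concat.2 (Or.inl ha))) ?_
    rintro rfl
    have := hlast _ _ (hv₁.trans hv₂.symm)
    simp only [List.getLast?_append, List.getLast?_singleton, Option.some_or,
      Option.some.injEq] at this
    exact ha.ne this
  · intro u₁ u₂ v₁ v₂ a h₁ h₂ hu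
    obtain ⟨x₁, hx₁, hu₁, hv₁⟩ := (hstep _ _ _).1 h₁
    obtain ⟨x₂, hx₂, hu₂, hv₂⟩ := (hstep _ _ _).1 h₂
    exact hmono _ _ _ _ hx₁ hx₂ hv₁ hv₂ (colexLT_concat.2
      (Or.inr ⟨rfl, hrefl _ _ _ _ (hpre _ _ hx₁) (hpre _ _ hx₂) hu₁ hu₂ hu⟩))
  · ext x
    have hB : x ∈ B.accepts ↔ ∃ t ∈ B.accept, t ∈ B.evalFrom {t₀} x := NFA.mem_accepts
    rw [hB]
    constructor
    · rintro ⟨t, ht, hx⟩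
      obtain ⟨y, hy, hyt⟩ := (hBacc _).1 ht
      obtain ⟨hxP, hxt⟩ := (hev _ _).1 hx
      exact hacc y x (hLP _ hy) hxP (hyt.trans hxt.symm) hy
    · intro hx
      obtain ⟨t, ht⟩ := hPT x (hLP _ hx)
      exact ⟨t, (hBacc _).2 ⟨x, hx, ht.symm⟩, (hev _ _).2 ⟨hLP _ hx, ht.symm⟩⟩

/-- A language is Wheeler if the words with a common long suffix never alternate between
different states of a deterministic automaton. -/
theorem IsDFAFor.isWheelerLanguage [Finite α] {Q : Type v} [Finite Q] {A : NFA α Q} {s : Q}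
    {L : Language α} (hA : IsDFAFor A s L) (n : ℕ)
    (h : ∀ x y z t : List α, ∀ p q r : Q, t.length = n + 1 → ColexLT x y → ColexLT y z →
      p ∈ A.evalFrom {s} (x ++ t) → q ∈ A.evalFrom {s} (y ++ t) → r ∈ A.evalFrom {s} (z ++ t) →
      q = p ∨ q = r) :
    IsWheelerLanguage L := by
  let cl : List α → List α × Set Q := fun x => (x.reverse.take (n + 1), A.evalFrom {s} x)
  let P : List α → Prop := fun x => ∃ z, x ++ z ∈ L
  have hmem : ∀ x, x ∈ L ↔ ∃ f ∈ A.accept, f ∈ A.evalFrom {s} x := by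
    intro x
    rw [← hA.accepts_eq, NFA.mem_accepts, hA.trim.start_eq]
  have hPne : ∀ x, P x → ∃ q, q ∈ A.evalFrom {s} x := by
    rintro x ⟨z, hz⟩
    obtain ⟨f, -, hf⟩ := (hmem _).1 hz
    obtain ⟨r, hr, -⟩ := mem_evalFrom_append.1 hf
    exact ⟨r, hr⟩
  have hsingle : ∀ x q, q ∈ A.evalFrom {s} x → A.evalFrom {s} x = {q} := fun x q hq =>
    Set.Subsingleton.eq_singleton_of_mem
      (fun _ h₁ _ h₂ => eq_of_mem_evalFrom hA.deterministic h₁ h₂) hq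
  have hcl : ∀ x y, cl x = cl y ↔
      x.reverse.take (n + 1) = y.reverse.take (n + 1) ∧ A.evalFrom {s} x = A.evalFrom {s} y :=
    fun _ _ => Prod.ext_iff
  have hfin : (cl '' {x | P x}).Finite := by
    refine ((List.finite_length_le α (n + 1)).prod (Set.finite_univ (α := Set Q))).subset ?_
    rintro _ ⟨x, -, rfl⟩
    refine ⟨?_, trivial⟩
    exact List.length_take_le _ _
  have := hfin.to_subtype
  -- The states of a Wheeler automaton must live in `Type`, whatever the universes of `α` and `Q`.
  let e := Finite.equivFin (cl '' {x | P x})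
  refine isWheelerLanguage_of_convex cl (fun t => (e.symm t).1)
    (Subtype.val_injective.comp e.symm.injective) (P := P) (fun _ => Iff.rfl) ?_ ?_ ?_ ?_ ?_ ?_ ?_
  · obtain ⟨z, f, hf, hz⟩ := hA.trim.coreachable s
    exact ⟨z, (hmem _).2 ⟨f, hf, hz⟩⟩
  · intro t
    obtain ⟨x, hx, hxt⟩ := (e.symm t).2
    exact ⟨x, hx, hxt⟩
  · intro x hx
    exact ⟨e ⟨cl x, x, hx, rfl⟩, congrArg Subtype.val (e.symm_apply_apply _)⟩
  · intro x y z hx hy hz hxy hyz hxz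
    obtain ⟨hxz, hev⟩ := (hcl _ _).1 hxz
    obtain ⟨x', hx'⟩ := eq_append_reverse_take_reverse x (n + 1)
    obtain ⟨z', hz'⟩ := eq_append_reverse_take_reverse z (n + 1)
    -- A shorter recorded suffix would be the whole word, forcing `x = z`.
    have hlen : (x.reverse.take (n + 1)).length = n + 1 := by
      by_contra hne
      have hne' := hne
      rw [hxz] at hne'
      rw [List.length_take] at hne hne'
      rw [List.take_of_length_le (by omega), List.take_of_length_le (by omega)] at hxz
      rw [List.reverse_injective hxz] at hxy
      exact ColexLT.irrefl _ (hxy.trans hyz)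
    rw [← hxz] at hz'
    generalize ht : (x.reverse.take (n + 1)).reverse = t at hx' hz'
    have htl : t.length = n + 1 := by rw [← ht, List.length_reverse, hlen]
    subst hx' hz'
    obtain ⟨y', rfl⟩ := exists_eq_append_of_colexLT hxy hyz
    obtain ⟨p, hp⟩ := hPne _ hx
    obtain ⟨q, hq⟩ := hPne _ hy
    have hqp : q = p := by
      have := h x' y' z' t p q p htl ((colexLT_append_right _).1 hxy)
        ((colexLT_append_right _).1 hyz) hp hq (hev ▸ hp)
      tauto
    subst hqp
    refine (hcl _ _).2 ⟨?_, by rw [hsingle _ _ hp, hsingle _ _ hq]⟩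
    rw [List.reverse_append, List.reverse_append, List.take_append_of_le_length (by simp [htl]),
      List.take_append_of_le_length (by simp [htl])]
  · rintro x y a hx hy hxy ⟨z, hz⟩
    obtain ⟨h₁, h₂⟩ := (hcl _ _).1 hxy
    have hev : A.evalFrom {s} (y ++ [a]) = A.evalFrom {s} (x ++ [a]) := by
      rw [NFA.evalFrom_append, NFA.evalFrom_append, h₂]
    refine ⟨⟨z, ?_⟩, (hcl _ _).2 ⟨?_, hev⟩⟩
    · rw [hmem, NFA.evalFrom_append] at hz ⊢
      rwa [hev]
    · have := congrArg (List.take n) h₁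
      rw [List.take_take, List.take_take, min_eq_left (Nat.le_succ n)] at this
      simp [this]
  -- The recorded length `n + 1` is positive, so the suffix determines the last letter.
  · intro x y hxy
    have := congrArg List.head? ((hcl _ _).1 hxy).1
    simpa [List.head?_take] using this
  · intro x y _ _ hxy hx
    rw [hmem] at hx ⊢
    rwa [← ((hcl _ _).1 hxy).2]

end Quotient

/-! ### Short witnesses from alternation. -/

section Bound

variable {α : Type u} [LinearOrder α] {Q : Type v} [Finite Q]

/-- The pair not known to be separated by last letters is shortened jointly, the third word alone;
last letters are kept, so the separated pair stays ordered. -/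
theorem exists_short_three {A : NFA α Q} {s p q r : Q} {x y z : List α} (hxy : ColexLT x y)
    (hyz : ColexLT y z) (hx : p ∈ A.evalFrom {s} x) (hy : q ∈ A.evalFrom {s} y)
    (hz : r ∈ A.evalFrom {s} z) (h : LastLT x y ∨ LastLT y z) :
    ∃ x' y' z' : List α, ColexLT x' y' ∧ ColexLT y' z' ∧ p ∈ A.evalFrom {s} x' ∧
      q ∈ A.evalFrom {s} y' ∧ r ∈ A.evalFrom {s} z' ∧
      x'.length ≤ Nat.card Q + Nat.card Q ^ 2 ∧ y'.length ≤ Nat.card Q + Nat.card Q ^ 2 ∧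
      z'.length ≤ Nat.card Q + Nat.card Q ^ 2 := by
  rcases h with h | h
  · obtain ⟨y', z', hyz', hy', hz', hye, -, hyl, hzl⟩ := hyz.exists_shorter hy hz
    obtain ⟨x', hx', hxl, hxe⟩ := exists_length_le_card_getLast hx
    exact ⟨x', y', z', h _ _ hxe hye, hyz', hx', hy', hz', by omega, hyl, hzl⟩
  · obtain ⟨x', y', hxy', hx', hy', -, hye, hxl, hyl⟩ := hxy.exists_shorter hx hy
    obtain ⟨z', hz', hzl, hze⟩ := exists_length_le_card_getLast hz
    exact ⟨x', y', z', hxy', h _ _ hye hze, hx', hy', hz', hxl, hyl, by omega⟩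

/-- Words that share a long suffix and alternate between different states give two short words
and a cycle comparing with both of them in the same way. -/
theorem exists_cycle_of_alternating {A : NFA α Q} {s p q r : Q}
    (hA : ∀ q a, (A.step q a).Subsingleton) {x y z t : List α} (hxy : ColexLT x y)
    (hyz : ColexLT y z) (hx : p ∈ A.evalFrom {s} (x ++ t)) (hy : q ∈ A.evalFrom {s} (y ++ t))
    (hz : r ∈ A.evalFrom {s} (z ++ t)) (hqp : q ≠ p) (hqr : q ≠ r)
    (ht : Nat.card Q ^ 3 ≤ t.length) :
    ∃ (μ ν γ : List α) (u v : Q), u ≠ v ∧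
      u ∈ A.evalFrom {s} μ ∧ v ∈ A.evalFrom {s} ν ∧
      u ∈ A.evalFrom {u} γ ∧ v ∈ A.evalFrom {v} γ ∧
      ((ColexLT μ γ ∧ ColexLT ν γ) ∨ (ColexLT γ μ ∧ ColexLT γ ν)) ∧
      μ.length < γ.length ∧ ν.length < γ.length ∧
      γ.length ≤ Nat.card Q + Nat.card Q ^ 2 + Nat.card Q ^ 3 := by
  obtain ⟨x₀, y₀, z₀, t₀, rfl, rfl, rfl, hxy₀, hyz₀, hlast⟩ := hxy.exists_lastLT_three hyz
  rw [List.append_assoc] at hx hy hz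
  obtain ⟨p₀, hx₀, hp⟩ := mem_evalFrom_append.1 hx
  obtain ⟨q₀, hy₀, hq⟩ := mem_evalFrom_append.1 hy
  obtain ⟨r₀, hz₀, hr⟩ := mem_evalFrom_append.1 hz
  obtain ⟨x₁, y₁, z₁, hxy₁, hyz₁, hx₁, hy₁, hz₁, hxl, hyl, hzl⟩ :=
    exists_short_three hxy₀ hyz₀ hx₀ hy₀ hz₀ hlast
  have hrun : (p, q, r) ∈ (prodNFA A (prodNFA A A)).evalFrom {(p₀, q₀, r₀)} (t₀ ++ t) :=
    mem_prodNFA_evalFrom.2 ⟨hp, mem_prodNFA_evalFrom.2 ⟨hq, hr⟩⟩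
  have hcard : Nat.card (Q × Q × Q) = Nat.card Q ^ 3 := by
    rw [Nat.card_prod, Nat.card_prod]; ring
  obtain ⟨t₁, c, t₂, ⟨p₁, q₁, r₁⟩, -, hc, hlen, h₁, h₂, h₃⟩ :=
    exists_cycle_of_card_le_length hrun (by rw [hcard, List.length_append]; omega)
  rw [hcard] at hlen
  simp only [mem_prodNFA_evalFrom] at h₁ h₂ h₃
  obtain ⟨hp₁, hq₁, hr₁⟩ := h₁
  obtain ⟨hpc, hqc, hrc⟩ := h₂
  obtain ⟨hp₂, hq₂, hr₂⟩ := h₃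
  have hqp₁ : q₁ ≠ p₁ := by
    rintro rfl
    exact hqp (eq_of_mem_evalFrom hA hq₂ hp₂)
  have hqr₁ : q₁ ≠ r₁ := by
    rintro rfl
    exact hqr (eq_of_mem_evalFrom hA hq₂ hr₂)
  have hx₂ := mem_evalFrom_append.2 ⟨_, hx₁, hp₁⟩
  have hy₂ := mem_evalFrom_append.2 ⟨_, hy₁, hq₁⟩
  have hz₂ := mem_evalFrom_append.2 ⟨_, hz₁, hr₁⟩
  have hxy₂ := (colexLT_append_right t₁).2 hxy₁
  have hyz₂ := (colexLT_append_right t₁).2 hyz₁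
  set m := Nat.card Q + Nat.card Q ^ 2 + t₁.length with hm
  have hcpos := List.length_pos_of_ne_nil hc
  -- The least multiple of `c.length` above `m`; the final bound follows from `t₁.length + c.length
  -- ≤ Nat.card Q ^ 3`.
  obtain ⟨k, hk₁, hk₂⟩ : ∃ k, m < k * c.length ∧ k * c.length ≤ m + c.length := by
    refine ⟨m / c.length + 1, ?_, ?_⟩
    · have := Nat.lt_mul_div_succ m hcpos
      rwa [mul_comm] at this
    · have := Nat.div_mul_le_self m c.length
      rw [Nat.add_mul, one_mul]
      omega
  set g := (List.replicate k c).flatten with hg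
  have hgl : g.length = k * c.length := by simp [hg]
  have hpg := mem_evalFrom_flatten_replicate hpc k
  have hqg := mem_evalFrom_flatten_replicate hqc k
  have hrg := mem_evalFrom_flatten_replicate hrc k
  have hxl₂ : (x₁ ++ t₁).length < g.length := by rw [List.length_append]; omega
  have hyl₂ : (y₁ ++ t₁).length < g.length := by rw [List.length_append]; omega
  have hzl₂ : (z₁ ++ t₁).length < g.length := by rw [List.length_append]; omega
  have hgl' : g.length ≤ Nat.card Q + Nat.card Q ^ 2 + Nat.card Q ^ 3 := by omega
  rcases colexLT_trichotomy (y₁ ++ t₁) g with h | h | h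
  · exact ⟨_, _, g, q₁, p₁, hqp₁, hy₂, hx₂, hqg, hpg, .inl ⟨h, hxy₂.trans h⟩, hyl₂, hxl₂, hgl'⟩
  · exact absurd (congrArg List.length h) hyl₂.ne
  · exact ⟨_, _, g, q₁, r₁, hqr₁, hy₂, hz₂, hqg, hrg, .inr ⟨h, h.trans hyz₂⟩, hyl₂, hzl₂, hgl'⟩

end Bound

end WheelerLang

theorem mainTheorem1 {α : Type*} [LinearOrder α] [Finite α] {Q : Type*} [Finite Q]
    (L : Language α) (A : NFA α Q) (s : Q)
    (hA : WheelerLang.IsMinimumDFA A s L ∨ WheelerLang.IsMinimumRootedDFA A s L) :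
    ¬ WheelerLang.IsWheelerLanguage L ↔
      ∃ (μ ν γ : List α) (u v : Q),
        u ≠ v ∧
        u ∈ A.evalFrom {s} μ ∧ v ∈ A.evalFrom {s} ν ∧
        u ∈ A.evalFrom {u} γ ∧ v ∈ A.evalFrom {v} γ ∧
        ((WheelerLang.ColexLT μ γ ∧ WheelerLang.ColexLT ν γ) ∨
          (WheelerLang.ColexLT γ μ ∧ WheelerLang.ColexLT γ ν)) ∧
        μ.length < γ.length ∧ ν.length < γ.length ∧
        γ.length ≤ 2 + Nat.card Q + 2 * Nat.card Q ^ 2 + Nat.card Q ^ 3 := by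
  have hD : WheelerLang.IsDFAFor A s L := hA.elim (·.isDFA) (·.isDFA)
  constructor
  · intro hL
    by_contra hno
    have : Nonempty Q := ⟨s⟩
    -- Positivity makes the truncated `Nat.card Q ^ 3 - 1`, plus one, equal to `Nat.card Q ^ 3`.
    have hpos : 0 < Nat.card Q ^ 3 := pow_pos Nat.card_pos 3
    refine hL (hD.isWheelerLanguage (Nat.card Q ^ 3 - 1) ?_)
    intro x y z t p q r ht hxy hyz hx hy hz
    by_contra! hne
    obtain ⟨μ, ν, γ, u, v, huv, hu, hv, huγ, hvγ, hlt, hμ, hν, hγ⟩ :=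
      WheelerLang.exists_cycle_of_alternating hD.deterministic hxy hyz hx hy hz hne.1 hne.2
        (by omega)
    exact hno ⟨μ, ν, γ, u, v, huv, hu, hv, huγ, hvγ, hlt, hμ, hν, by omega⟩
  · rintro ⟨μ, ν, γ, u, v, huv, hu, hv, huγ, hvγ, hlt, hμ, hν, -⟩ hL
    have heq := hD.acceptsFrom_eq_of_isWheelerLanguage hL hu hv huγ hvγ hlt hμ hν
    -- A nonempty cycle keeps `u` and `v` away from `s` under the rooted convention, where `s` may
    -- share its right language with another state.
    have hγ : γ ≠ [] := List.ne_nil_of_length_pos (Nat.zero_lt_of_lt hμ)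
    rcases hA with hA | hA
    · exact huv (hA.eq_of_acceptsFrom_eq heq)
    · exact huv (hA.eq_of_acceptsFrom_eq (hA.noIncoming.ne_of_mem_evalFrom hγ huγ)
        (hA.noIncoming.ne_of_mem_evalFrom hγ hvγ) heq)
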